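/- Let $d$ be the dimension of the lattice $\mathbb Z^d$, with graph distance $d_1(x,y)=\sum_i|x_i-y_i|$. Let $(\mathcal C_x)_{x\in\mathbb Z^d}$ be influence classes: each $\mathcal C_x$ is a collection of subsets of $\mathbb Z^d$ such that (a) $x\notin A$ for all $A\in\mathcal C_x$; (b) $\mathcal C_x=\mathcal C_0+x$ for all $x$; (c) there is $r<\infty$ such that every $A\in\mathcal C_x$ is contained in $\{y: 1\le d_1(x,y)\le r\}$. For $q\in[0,1]$ let $\nu$ be the probability measure on $\{0,1\}$ with $\nu(0)=q$, $\nu(1)=1-q$, and let $\mu$ be the product measure $\nu^{\otimes\mathbb Z^d}$ on $\Omega=\{0,1\}^{\mathbb Z^d}$. For $\eta\in\Omega$ put $c_x(\eta)=1$ if there is $A\in\mathcal C_x$ with $\eta_y=0$ for all $y\in A$, and $c_x(\eta)=0$ otherwise. The generator $\mathcal L$ of the corresponding 0-1 kinetically constrained spin model (KCSM) is the self-adjoint operator on $L^2(\Omega,\mu)$ associated with the Dirichlet form $$\mathcal D(f)=\sum_{x\in\mathbb Z^d}\mu\big(c_x\,\mathrm{Var}_x(f)\big),$$ defined for the $f\in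 L^2(\mu)$ for which it is finite, that is, $\mathcal D(f,g)=\langle-\mathcal Lf,g\rangle$ for the polarized form; here $\mathrm{Var}_x(f)$ is the variance of $f$ with respect to $\eta_x\sim\nu$ with the other variables fixed. On functions of finitely many variables, $\mathcal Lf=\sum_x c_x(\nu_x(f)-f)$, where $\nu_x(f)$ is the average of $f$ over $\eta_x\sim\nu$. The eigenvalue $0$ of $\mathcal L$ is simple if $\{f\in\mathrm{Dom}(\mathcal L):\mathcal Lf=0\}$ is one-dimensional. Define $$q_c=\inf\{q\in(0,1]:\ 0\text{ is a simple eigenvalue of }\mathcal L\}.$$ Let $T:\Omega\to\Omega$ be the bootstrap map: $T(\eta)_x=0$ if $\eta_x=0$ or $c_x(\eta)=1$, and $T(\eta)_x=1$ otherwise. Let $\mu^{(n)}$ be the law of $T^n(\eta)$ when $\eta$ has law $\mu$, let $\mu^{(\infty)}$ be the weak limit of $\mu^{(n)}$ as $n\to\infty$, and let $$q_{bp}=\inf\{q\in[0,1]:\ \mu^{(\infty)}(\eta_0=0)=1\}.$$ Then, for every such $(\mathcal C_x)_x$ (kept fixed while $q$ varies), $q_c=q_{bp}$, and for every $q\in[0,1]$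 with $q>q_c$, $0$ is a simple eigenvalue of $\mathcal L$. -/

import Mathlib

open MeasureTheory ProbabilityTheory Filter Topology
open scoped ENNReal unitInterval

noncomputable section

/-! ### Configurations and the product measure -/

namespace KCSM

/-- Sites of the integer lattice `ℤ^d`. -/
abbrev Site (d : ℕ) := Fin d → ℤ

/-- Configurations `η ∈ {0,1}^{ℤ^d}`; `0` is the good (empty) state. -/
abbrev Config (d : ℕ) := Site d → Fin 2

/-- The graph distance `d₁(x,y) = ∑ᵢ |xᵢ - yᵢ|` on `ℤ^d`. -/
def dist₁ {d : ℕ} (x y : Site d) : ℕ := ∑ i, (x i - y i).natAbs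

/-- The single-site law `ν` on `{0,1}`: `ν(0) = q`, `ν(1) = 1 - q`. -/
def siteLaw (q : I) : Measure (Fin 2) := bernoulliMeasure 0 1 q

instance (q : I) : IsProbabilityMeasure (siteLaw q) := by
  unfold siteLaw; infer_instance

/-- The product measure `μ = ∏_{x ∈ ℤ^d} ν`. -/
def prodLaw (d : ℕ) (q : I) : Measure (Config d) :=
  Measure.infinitePi fun _ : Site d => siteLaw q

instance (d : ℕ) (q : I) : IsProbabilityMeasure (prodLaw d q) := by
  unfold prodLaw; infer_instance

/-- The real Hilbert space `L²({0,1}^{ℤ^d}, μ)`. -/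
abbrev L2 (d : ℕ) (q : I) := Lp ℝ 2 (prodLaw d q)

/-! ### Influence classes and constraints -/

/-- A translation invariant, finite range collection of influence classes `(𝒞_x)_{x ∈ ℤ^d}`; it
determines a 0-1 KCSM up to the choice of the parameter `q`. -/
structure InfluenceClasses (d : ℕ) where
  /-- the collection `𝒞_x` of subsets of `ℤ^d` -/
  cls : Site d → Set (Set (Site d))
  notMem_self : ∀ x, ∀ A ∈ cls x, x ∉ A
  translate : ∀ x, cls x = (fun A => (fun y => y + x) '' A) '' cls 0
  finite_range : ∃ r : ℕ, ∀ x, ∀ A ∈ cls x, ∀ y ∈ A, 1 ≤ dist₁ x y ∧ dist₁ x y ≤ r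

variable {d : ℕ}

/-- The constraint at `x` is satisfied by `η`: some `A ∈ 𝒞_x` is entirely empty in `η`. -/
def InfluenceClasses.Satisfied (C : InfluenceClasses d) (x : Site d) (η : Config d) : Prop :=
  ∃ A ∈ C.cls x, ∀ y ∈ A, η y = 0

open Classical in
/-- The indicator `c_x(η)` of the constraint at `x`. -/
def InfluenceClasses.rate (C : InfluenceClasses d) (x : Site d) (η : Config d) : ℝ :=
  if C.Satisfied x η then 1 else 0

lemma finite_dist₁_le (x : Site d) (r : ℕ) : {y : Site d | dist₁ x y ≤ r}.Finite := by
  refine (Set.finite_Icc (fun i => x i - r) (fun i => x i + r)).subset ?_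
  intro y hy
  have h : ∀ i, (x i - y i).natAbs ≤ r := fun i =>
    (Finset.single_le_sum (f := fun i => (x i - y i).natAbs) (fun _ _ => Nat.zero_le _)
      (Finset.mem_univ i)).trans hy
  constructor <;> intro i <;> have := h i <;> simp only <;> omega

lemma InfluenceClasses.cls_finite (C : InfluenceClasses d) (x : Site d) : (C.cls x).Finite := by
  obtain ⟨r, hr⟩ := C.finite_range
  exact (finite_dist₁_le x r).finite_subsets.subset fun A hA y hy => (hr x A hA y hy).2

lemma InfluenceClasses.measurableSet_satisfied (C : InfluenceClasses d) (x : Site d) :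
    MeasurableSet {η : Config d | C.Satisfied x η} := by
  have : {η : Config d | C.Satisfied x η} = ⋃ A ∈ C.cls x, ⋂ y ∈ A, {η | η y = 0} := by
    ext η; simp [InfluenceClasses.Satisfied]
  rw [this]
  refine MeasurableSet.biUnion (C.cls_finite x).countable fun A _ => ?_
  refine MeasurableSet.biInter (Set.to_countable A) fun y _ => ?_
  exact measurable_pi_apply y (measurableSet_singleton 0)

lemma InfluenceClasses.measurable_rate (C : InfluenceClasses d) (x : Site d) :
    Measurable (C.rate x) :=
  Measurable.ite (C.measurableSet_satisfied x) measurable_const measurable_const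

lemma InfluenceClasses.rate_nonneg (C : InfluenceClasses d) (x : Site d) (η : Config d) :
    0 ≤ C.rate x η := by
  unfold InfluenceClasses.rate; split_ifs <;> norm_num

lemma InfluenceClasses.rate_le_one (C : InfluenceClasses d) (x : Site d) (η : Config d) :
    C.rate x η ≤ 1 := by
  unfold InfluenceClasses.rate; split_ifs <;> norm_num

/-! ### Bootstrap percolation -/

open Classical in
/-- The bootstrap map: `T(η)_x = 0` iff `η_x = 0` or the constraint at `x` is satisfied by `η`. -/
def InfluenceClasses.bootstrap (C : InfluenceClasses d) (η : Config d) : Config d :=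
  fun x => if η x = 0 ∨ C.Satisfied x η then 0 else 1

lemma InfluenceClasses.measurable_bootstrap (C : InfluenceClasses d) :
    Measurable C.bootstrap := by
  refine measurable_pi_lambda _ fun x => Measurable.ite ?_ measurable_const measurable_const
  exact (measurable_pi_apply x (measurableSet_singleton 0)).union (C.measurableSet_satisfied x)

/-- The law `μ^{(n)}` of `T^n(η)` when `η` has law `μ`. -/
def InfluenceClasses.bootstrapLaw (C : InfluenceClasses d) (q : I) (n : ℕ) :
    ProbabilityMeasure (Config d) :=
  ProbabilityMeasure.map ⟨prodLaw d q, inferInstance⟩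
    (C.measurable_bootstrap.iterate n).aemeasurable

/-- The law `μ^{(n)}` converges weakly to some `μ^{(∞)}`, and `μ^{(∞)}(η_0 = 0) = 1`. -/
def InfluenceClasses.Empties (C : InfluenceClasses d) (q : I) : Prop :=
  ∃ m : ProbabilityMeasure (Config d),
    Tendsto (fun n => C.bootstrapLaw q n) atTop (𝓝 m) ∧
      (m : Measure (Config d)) {η | η 0 = 0} = 1

/-- The bootstrap percolation threshold
`q_bp = inf {q ∈ [0,1] : μ^{(∞)}(η_0 = 0) = 1}`. -/
def InfluenceClasses.qbp (C : InfluenceClasses d) : ℝ :=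
  sInf {q : ℝ | ∃ h : q ∈ Set.Icc (0 : ℝ) 1, C.Empties ⟨q, h⟩}

/-! ### The Dirichlet form -/

/-- The local variance `Var_x(f)(η)`: the variance of `f` with respect to the variable `η_x`, drawn
from `ν`, the other variables being held fixed. -/
def localVar (q : I) (x : Site d) (f : Config d → ℝ) (η : Config d) : ℝ :=
  Var[fun s => f (Function.update η x s); siteLaw q]

/-- The local covariance `Cov_x(f,g)(η)`, the polarization of `Var_x`. -/
def localCov (q : I) (x : Site d) (f g : Config d → ℝ) (η : Config d) : ℝ :=
  cov[fun s => f (Function.update η x s), fun s => g (Function.update η x s); siteLaw q]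

/-- The Dirichlet form `𝒟(f) = ∑_x μ(c_x Var_x(f)) ∈ [0,∞]`. -/
def InfluenceClasses.dirichlet (C : InfluenceClasses d) (q : I) (f : Config d → ℝ) : ℝ≥0∞ :=
  ∑' x : Site d, ∫⁻ η, ENNReal.ofReal (C.rate x η * localVar q x f η) ∂(prodLaw d q)

/-- The summand `μ(c_x Cov_x(f,g))` of the polarized Dirichlet form. -/
def InfluenceClasses.dirichletTerm (C : InfluenceClasses d) (q : I) (x : Site d)
    (f g : Config d → ℝ) : ℝ :=
  ∫ η, C.rate x η * localCov q x f g η ∂(prodLaw d q)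

/-! Facts needed to build the generator as a linear operator. -/

/-- Resampling the variable at `x` preserves `μ`. -/
lemma measurePreserving_update (q : I) (x : Site d) :
    MeasurePreserving (fun p : Config d × Fin 2 => Function.update p.1 x p.2)
      ((prodLaw d q).prod (siteLaw q)) (prodLaw d q) := by
  have hm : Measurable (fun p : Config d × Fin 2 => Function.update p.1 x p.2) := by
    refine measurable_pi_lambda _ fun y => ?_
    by_cases h : y = x
    · subst h; simpa using measurable_snd
    · simp only [Function.update_of_ne h]
      exact (measurable_pi_apply y).comp measurable_fst
  refine ⟨hm, ?_⟩
  refine Measure.eq_infinitePi _ fun s t ht => ?_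
  rw [Measure.map_apply hm (MeasurableSet.pi s.countable_toSet fun i _ => ht i)]
  by_cases hx : x ∈ s
  · have : (fun p : Config d × Fin 2 => Function.update p.1 x p.2) ⁻¹' (Set.pi s t)
        = (Set.pi (s.erase x) t) ×ˢ (t x) := by
      ext ⟨η, a⟩
      simp only [Set.mem_preimage, Set.mem_pi, Set.mem_prod, Finset.mem_coe, Finset.mem_erase]
      constructor
      · intro h
        refine ⟨fun y hy => ?_, by simpa using h x hx⟩
        simpa [Function.update_of_ne hy.1] using h y hy.2
      · rintro ⟨h1, h2⟩ y hy
        by_cases hyx : y = x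
        · subst hyx; simpa using h2
        · simpa [Function.update_of_ne hyx] using h1 y ⟨hyx, hy⟩
    rw [this, Measure.prod_prod, prodLaw, Measure.infinitePi_pi _ (fun i _ => ht i),
      Finset.prod_erase_mul s (fun i => siteLaw q (t i)) hx]
  · have : (fun p : Config d × Fin 2 => Function.update p.1 x p.2) ⁻¹' (Set.pi s t)
        = (Set.pi s t) ×ˢ (Set.univ : Set (Fin 2)) := by
      ext ⟨η, a⟩
      simp only [Set.mem_preimage, Set.mem_pi, Set.mem_prod, Finset.mem_coe, Set.mem_univ,
        and_true]
      refine forall₂_congr fun y hy => ?_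
      have hyx : y ≠ x := fun h => hx (h ▸ hy)
      rw [Function.update_of_ne hyx]
    rw [this, Measure.prod_prod, prodLaw, Measure.infinitePi_pi _ (fun i _ => ht i)]
    simp

lemma ae_update {q : I} (x : Site d) {f g : Config d → ℝ} (h : f =ᵐ[prodLaw d q] g) :
    ∀ᵐ η ∂(prodLaw d q), (fun s => f (Function.update η x s)) =ᵐ[siteLaw q]
      (fun s => g (Function.update η x s)) :=
  Measure.ae_ae_of_ae_prod ((measurePreserving_update q x).quasiMeasurePreserving.ae_eq_comp h)

lemma localCov_congr {q : I} (x : Site d) {f f' g g' : Config d → ℝ}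
    (hf : f =ᵐ[prodLaw d q] f') (hg : g =ᵐ[prodLaw d q] g') :
    localCov q x f g =ᵐ[prodLaw d q] localCov q x f' g' := by
  filter_upwards [ae_update x hf, ae_update x hg] with η h1 h2
  have e1 := integral_congr_ae h1
  have e2 := integral_congr_ae h2
  unfold localCov covariance
  rw [e1, e2]
  refine integral_congr_ae ?_
  filter_upwards [h1, h2] with s k1 k2
  rw [k1, k2]

lemma localVar_eq (q : I) (x : Site d) (f : Config d → ℝ) : localVar q x f = localCov q x f f := by
  funext η
  exact (covariance_self (Measurable.of_discrete).aemeasurable).symm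

lemma localVar_nonneg (q : I) (x : Site d) (f : Config d → ℝ) (η : Config d) :
    0 ≤ localVar q x f η := variance_nonneg _ _

lemma memLp_fin (q : I) (u : Fin 2 → ℝ) : MemLp u 2 (siteLaw q) := MemLp.of_discrete

lemma localCov_add_left (q : I) (x : Site d) (f f' g : Config d → ℝ) :
    localCov q x (f + f') g = localCov q x f g + localCov q x f' g := by
  funext η
  exact covariance_add_left (memLp_fin q _) (memLp_fin q _) (memLp_fin q _)

lemma localCov_smul_left (q : I) (x : Site d) (c : ℝ) (f g : Config d → ℝ) :
    localCov q x (c • f) g = c • localCov q x f g := by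
  funext η
  exact covariance_smul_left c

lemma localVar_add_le (q : I) (x : Site d) (f g : Config d → ℝ) (η : Config d) :
    localVar q x (f + g) η ≤ 2 * localVar q x f η + 2 * localVar q x g η := by
  have h1 := variance_add (memLp_fin q fun s => f (Function.update η x s))
    (memLp_fin q fun s => g (Function.update η x s))
  have h2 := variance_sub (memLp_fin q fun s => f (Function.update η x s))
    (memLp_fin q fun s => g (Function.update η x s))
  have h3 := variance_nonneg ((fun s => f (Function.update η x s)) -
    fun s => g (Function.update η x s)) (siteLaw q)
  have h4 : localVar q x (f + g) η = Var[(fun s => f (Function.update η x s)) +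
    fun s => g (Function.update η x s); siteLaw q] := rfl
  unfold localVar at *
  linarith

lemma abs_localCov_le (q : I) (x : Site d) (f g : Config d → ℝ) (η : Config d) :
    |localCov q x f g η| ≤ localVar q x f η + localVar q x g η := by
  have h1 := variance_add (memLp_fin q fun s => f (Function.update η x s))
    (memLp_fin q fun s => g (Function.update η x s))
  have h2 := variance_sub (memLp_fin q fun s => f (Function.update η x s))
    (memLp_fin q fun s => g (Function.update η x s))
  have h3 := variance_nonneg ((fun s => f (Function.update η x s)) -
    fun s => g (Function.update η x s)) (siteLaw q)
  have h4 := variance_nonneg ((fun s => f (Function.update η x s)) +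
    fun s => g (Function.update η x s)) (siteLaw q)
  have h5 := localVar_nonneg q x f η
  have h6 := localVar_nonneg q x g η
  unfold localVar localCov at *
  rw [abs_le]
  constructor <;> linarith

lemma aestronglyMeasurable_resample {q : I} (x : Site d) {f : Config d → ℝ}
    (hf : AEStronglyMeasurable f (prodLaw d q)) :
    AEStronglyMeasurable (fun η => ∫ s, f (Function.update η x s) ∂(siteLaw q)) (prodLaw d q) :=
  (hf.comp_measurePreserving (measurePreserving_update q x)).integral_prod_right'

lemma localCov_eq (q : I) (x : Site d) (f g : Config d → ℝ) :
    localCov q x f g = fun η => (∫ s, (f * g) (Function.update η x s) ∂(siteLaw q)) -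
      (∫ s, f (Function.update η x s) ∂(siteLaw q)) *
        (∫ s, g (Function.update η x s) ∂(siteLaw q)) := by
  funext η
  exact covariance_eq_sub (memLp_fin q _) (memLp_fin q _)

lemma aestronglyMeasurable_localCov {q : I} (x : Site d) {f g : Config d → ℝ}
    (hf : AEStronglyMeasurable f (prodLaw d q)) (hg : AEStronglyMeasurable g (prodLaw d q)) :
    AEStronglyMeasurable (localCov q x f g) (prodLaw d q) := by
  rw [localCov_eq]
  exact (aestronglyMeasurable_resample x (hf.mul hg)).sub
    ((aestronglyMeasurable_resample x hf).mul (aestronglyMeasurable_resample x hg))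

lemma integrable_localVar {q : I} (x : Site d) {f : Config d → ℝ} (hf : MemLp f 2 (prodLaw d q)) :
    Integrable (localVar q x f) (prodLaw d q) := by
  have h1 : Integrable (fun η => ∫ s, (f * f) (Function.update η x s) ∂(siteLaw q))
      (prodLaw d q) :=
    ((measurePreserving_update q x).integrable_comp_of_integrable
      (hf.integrable_mul hf)).integral_prod_left
  refine h1.mono' ?_ (ae_of_all _ fun η => ?_)
  · rw [localVar_eq]; exact aestronglyMeasurable_localCov x hf.1 hf.1
  · rw [Real.norm_of_nonneg (localVar_nonneg q x f η), localVar_eq, localCov_eq]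
    have := mul_self_nonneg (∫ s, f (Function.update η x s) ∂(siteLaw q))
    simp only
    linarith

lemma integrable_rate_localCov (C : InfluenceClasses d) {q : I} (x : Site d) {f g : Config d → ℝ}
    (hf : MemLp f 2 (prodLaw d q)) (hg : MemLp g 2 (prodLaw d q)) :
    Integrable (fun η => C.rate x η * localCov q x f g η) (prodLaw d q) := by
  refine ((integrable_localVar x hf).add (integrable_localVar x hg)).mono' ?_
    (ae_of_all _ fun η => ?_)
  · exact (C.measurable_rate x).aestronglyMeasurable.mul (aestronglyMeasurable_localCov x hf.1 hg.1)
  · rw [norm_mul, Real.norm_eq_abs, Real.norm_eq_abs, abs_of_nonneg (C.rate_nonneg x η)]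
    refine (mul_le_of_le_one_left (abs_nonneg _) (C.rate_le_one x η)).trans ?_
    exact abs_localCov_le q x f g η

lemma InfluenceClasses.dirichletTerm_congr (C : InfluenceClasses d) {q : I} (x : Site d)
    {f f' g g' : Config d → ℝ} (hf : f =ᵐ[prodLaw d q] f') (hg : g =ᵐ[prodLaw d q] g') :
    C.dirichletTerm q x f g = C.dirichletTerm q x f' g' := by
  refine integral_congr_ae ?_
  filter_upwards [localCov_congr x hf hg] with η h
  rw [h]

lemma InfluenceClasses.dirichlet_congr (C : InfluenceClasses d) {q : I} {f f' : Config d → ℝ}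
    (hf : f =ᵐ[prodLaw d q] f') : C.dirichlet q f = C.dirichlet q f' := by
  refine tsum_congr fun x => lintegral_congr_ae ?_
  filter_upwards [localCov_congr x hf hf] with η h
  rw [localVar_eq, localVar_eq, h]

lemma InfluenceClasses.dirichletTerm_add (C : InfluenceClasses d) {q : I} (x : Site d)
    (f f' g : L2 d q) : C.dirichletTerm q x ⇑(f + f') g =
      C.dirichletTerm q x f g + C.dirichletTerm q x f' g := by
  rw [C.dirichletTerm_congr x (Lp.coeFn_add f f') (ae_eq_refl _), dirichletTerm,
    localCov_add_left, dirichletTerm, dirichletTerm, ← integral_add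
      (integrable_rate_localCov C x (Lp.memLp f) (Lp.memLp g))
      (integrable_rate_localCov C x (Lp.memLp f') (Lp.memLp g))]
  simp only [Pi.add_apply, mul_add]

lemma InfluenceClasses.dirichletTerm_smul (C : InfluenceClasses d) {q : I} (x : Site d) (c : ℝ)
    (f g : L2 d q) : C.dirichletTerm q x ⇑(c • f) g = c * C.dirichletTerm q x f g := by
  rw [C.dirichletTerm_congr x (Lp.coeFn_smul c f) (ae_eq_refl _), dirichletTerm,
    localCov_smul_left, dirichletTerm, ← integral_const_mul]
  simp only [Pi.smul_apply, smul_eq_mul, mul_left_comm]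

lemma InfluenceClasses.dirichlet_zero (C : InfluenceClasses d) (q : I) :
    C.dirichlet q ⇑(0 : L2 d q) = 0 := by
  rw [C.dirichlet_congr (Lp.coeFn_zero ℝ 2 (prodLaw d q))]
  simp [dirichlet, localVar_eq, localCov]

lemma InfluenceClasses.dirichlet_add (C : InfluenceClasses d) {q : I} {f g : L2 d q}
    (hf : C.dirichlet q f ≠ ∞) (hg : C.dirichlet q g ≠ ∞) : C.dirichlet q ⇑(f + g) ≠ ∞ := by
  rw [C.dirichlet_congr (Lp.coeFn_add f g)]
  have key : C.dirichlet q (⇑f + ⇑g) ≤ 2 * C.dirichlet q f + 2 * C.dirichlet q g := by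
    unfold dirichlet
    rw [← ENNReal.tsum_mul_left, ← ENNReal.tsum_mul_left, ← ENNReal.tsum_add]
    refine ENNReal.tsum_le_tsum fun x => ?_
    have hm : AEMeasurable (fun η => 2 * ENNReal.ofReal (C.rate x η * localVar q x f η))
        (prodLaw d q) := by
      refine ((((C.measurable_rate x).aemeasurable.mul
        (integrable_localVar x (Lp.memLp f)).aemeasurable)).ennreal_ofReal).const_mul 2
    rw [← lintegral_const_mul' _ _ (by norm_num), ← lintegral_const_mul' _ _ (by norm_num),
      ← lintegral_add_left' hm]
    refine lintegral_mono fun η => ?_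
    have h0 := C.rate_nonneg x η
    have h1 := localVar_nonneg q x f η
    have h2 := localVar_nonneg q x g η
    have h3 : ∀ a : ℝ≥0∞, 2 * a = ENNReal.ofReal 2 * a := fun a => by simp
    simp only
    rw [h3, h3, ← ENNReal.ofReal_mul (by norm_num), ← ENNReal.ofReal_mul (by norm_num),
      ← ENNReal.ofReal_add (by positivity) (by positivity)]
    refine ENNReal.ofReal_le_ofReal ?_
    nlinarith [mul_le_mul_of_nonneg_left (localVar_add_le q x f g η) h0]
  refine ne_top_of_le_ne_top ?_ key
  exact ENNReal.add_ne_top.2 ⟨ENNReal.mul_ne_top (by norm_num) hf,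
    ENNReal.mul_ne_top (by norm_num) hg⟩

lemma InfluenceClasses.dirichlet_smul (C : InfluenceClasses d) {q : I} (c : ℝ) {f : L2 d q}
    (hf : C.dirichlet q f ≠ ∞) : C.dirichlet q ⇑(c • f) ≠ ∞ := by
  rw [C.dirichlet_congr (Lp.coeFn_smul c f)]
  have key : C.dirichlet q (c • ⇑f) = ENNReal.ofReal (c ^ 2) * C.dirichlet q f := by
    unfold dirichlet
    rw [← ENNReal.tsum_mul_left]
    refine tsum_congr fun x => ?_
    rw [← lintegral_const_mul' _ _ (by simp)]
    refine lintegral_congr fun η => ?_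
    rw [← ENNReal.ofReal_mul (by positivity)]
    congr 1
    have : localVar q x (c • ⇑f) η = c ^ 2 * localVar q x f η := variance_smul c _ _
    rw [this]; ring
  rw [key]
  exact ENNReal.mul_ne_top (by simp) hf

/-! ### The generator -/

/-- The domain of the Dirichlet form: `f ∈ L²(μ)` with `𝒟(f) < ∞`. -/
def InfluenceClasses.formDomain (C : InfluenceClasses d) (q : I) : Submodule ℝ (L2 d q) where
  carrier := {f | C.dirichlet q f ≠ ∞}
  zero_mem' := by
    change C.dirichlet q _ ≠ ∞
    rw [C.dirichlet_zero q]
    exact ENNReal.zero_ne_top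
  add_mem' := fun hf hg => C.dirichlet_add hf hg
  smul_mem' := fun c _ hf => C.dirichlet_smul c hf

/-- The graph of the generator: the pairs `(f, h)` such that `f` has finite Dirichlet form and
`𝒟(f, g) = -⟨h, g⟩` for all `g` of finite Dirichlet form, where
`𝒟(f, g) = ∑_x μ(c_x Cov_x(f, g))`. -/
def InfluenceClasses.generatorGraph (C : InfluenceClasses d) (q : I) :
    Submodule ℝ (L2 d q × L2 d q) where
  carrier := {p | p.1 ∈ C.formDomain q ∧ ∀ g ∈ C.formDomain q,
    HasSum (fun x => C.dirichletTerm q x p.1 g) (-inner ℝ p.2 g)}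
  zero_mem' := by
    refine ⟨Submodule.zero_mem _, fun g _ => ?_⟩
    have h : ∀ x, C.dirichletTerm q x ⇑(0 : L2 d q) g = 0 := fun x => by
      simpa using C.dirichletTerm_smul x 0 (0 : L2 d q) g
    simp only [Prod.fst_zero, Prod.snd_zero, h, inner_zero_left, neg_zero]
    exact hasSum_zero
  add_mem' := by
    rintro p p' ⟨h1, h2⟩ ⟨h1', h2'⟩
    refine ⟨Submodule.add_mem _ h1 h1', fun g hg => ?_⟩
    have h := (h2 g hg).add (h2' g hg)
    simp only [Prod.fst_add, Prod.snd_add, C.dirichletTerm_add, inner_add_left, neg_add]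
    exact h
  smul_mem' := by
    rintro c p ⟨h1, h2⟩
    refine ⟨Submodule.smul_mem _ c h1, fun g hg => ?_⟩
    have h := (h2 g hg).mul_left c
    simp only [Prod.smul_fst, Prod.smul_snd, C.dirichletTerm_smul, inner_smul_left]
    simpa using h

/-- The generator `ℒ` of the 0-1 KCSM with influence classes `C` and parameter `q`: the (unbounded)
self-adjoint operator on `L²(μ)` associated with the Dirichlet form `𝒟`, that is,
`𝒟(f, g) = ⟨-ℒ f, g⟩`. On functions of finitely many variables it is
`ℒ f = ∑_x c_x (ν_x(f) - f)`. (That the graph is single-valued is `generator_graph` below.) -/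
def InfluenceClasses.generator (C : InfluenceClasses d) (q : I) : L2 d q →ₗ.[ℝ] L2 d q :=
  (C.generatorGraph q).toLinearPMap

/-- The form domain contains the indicators of cylinder events. -/
lemma InfluenceClasses.indicator_mem_formDomain (C : InfluenceClasses d) (q : I)
    {A : Set (Config d)} (hA : A ∈ measurableCylinders fun _ : Site d => Fin 2)
    (hA' : MeasurableSet A) :
    indicatorConstLp 2 hA' (measure_ne_top (prodLaw d q) A) (1 : ℝ) ∈ C.formDomain q := by
  change C.dirichlet q _ ≠ ∞
  set f := indicatorConstLp 2 hA' (measure_ne_top (prodLaw d q) A) (1 : ℝ) with hf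
  obtain ⟨s, S, -, rfl⟩ := (mem_measurableCylinders A).1 hA
  have hzero : ∀ x ∉ s, ∫⁻ η, ENNReal.ofReal (C.rate x η * localVar q x f η) ∂(prodLaw d q)
      = 0 := by
    intro x hx
    have hc := localCov_congr (q := q) x (indicatorConstLp_coeFn (p := 2) (hs := hA')
      (hμs := measure_ne_top (prodLaw d q) _) (c := (1 : ℝ))) (indicatorConstLp_coeFn (p := 2)
      (hs := hA') (hμs := measure_ne_top (prodLaw d q) _) (c := (1 : ℝ)))
    rw [← lintegral_zero (μ := prodLaw d q)]
    refine lintegral_congr_ae ?_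
    filter_upwards [hc] with η h
    rw [localVar_eq, h]
    have hconst : ∀ a : Fin 2, (cylinder s S).indicator (fun _ => (1 : ℝ)) (Function.update η x a)
        = (cylinder s S).indicator (fun _ => (1 : ℝ)) η := by
      intro a
      have : s.restrict (Function.update η x a) = s.restrict η := by
        funext y
        have : (y : Site d) ≠ x := fun h => hx (h ▸ y.2)
        simp [Finset.restrict, Function.update_of_ne this]
      by_cases hη : η ∈ cylinder s S
      · have h2 : Function.update η x a ∈ cylinder s S := by
          rw [mem_cylinder] at hη ⊢; rwa [this]
        simp [Set.indicator_of_mem, hη, h2]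
      · have h2 : Function.update η x a ∉ cylinder s S := by
          rw [mem_cylinder] at hη ⊢; rwa [this]
        simp [Set.indicator_of_notMem, hη, h2]
    simp only [localCov, hconst]
    rw [covariance_const_left]
    simp
  unfold dirichlet
  rw [tsum_eq_sum (s := s) hzero]
  refine ENNReal.sum_ne_top.2 fun x _ => ?_
  have := integrable_rate_localCov C x (Lp.memLp f) (Lp.memLp f)
  rw [← localVar_eq] at this
  exact this.lintegral_lt_top.ne

lemma InfluenceClasses.generatorGraph_functional (C : InfluenceClasses d) (q : I) :
    ∀ p ∈ C.generatorGraph q, p.1 = 0 → p.2 = 0 := by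
  rintro ⟨f, h⟩ ⟨-, hp⟩ (rfl : f = 0)
  have hort : ∀ g ∈ C.formDomain q, inner ℝ h g = 0 := by
    intro g hg
    have h0 : ∀ x, C.dirichletTerm q x ⇑(0 : L2 d q) g = 0 := fun x => by
      simpa using C.dirichletTerm_smul x 0 (0 : L2 d q) g
    have h1 := hp g hg
    simp only [h0] at h1
    have h2 := h1.unique hasSum_zero
    simpa using h2
  have hcyl : ∀ A ∈ measurableCylinders fun _ : Site d => Fin 2,
      ∫ η in A, h η ∂(prodLaw d q) = 0 := by
    intro A hA
    have hA' := MeasurableSet.of_mem_measurableCylinders hA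
    have h1 := hort _ (C.indicator_mem_formDomain q hA hA')
    rw [real_inner_comm, L2.inner_indicatorConstLp_one] at h1
    exact h1
  have hint : Integrable h (prodLaw d q) := (Lp.memLp h).integrable (by norm_num)
  have hall : ∀ A, MeasurableSet A → ∫ η in A, h η ∂(prodLaw d q) = 0 := by
    intro A hA
    induction A, hA using MeasurableSpace.induction_on_inter
      (generateFrom_measurableCylinders (α := fun _ : Site d => Fin 2)).symm
      isPiSystem_measurableCylinders with
    | empty => simp
    | basic t ht => exact hcyl t ht
    | compl t ht ih =>
      have h1 := integral_add_compl ht hint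
      have h2 := hcyl Set.univ (univ_mem_measurableCylinders _)
      rw [Measure.restrict_univ] at h2
      linarith
    | iUnion t hd ht ih =>
      rw [integral_iUnion ht hd hint.integrableOn]
      simp [ih]
  have := hint.ae_eq_zero_of_forall_setIntegral_eq_zero fun A hA _ => hall A hA
  exact (Lp.eq_zero_iff_ae_eq_zero).2 this

/-- `generatorGraph` is the graph of `generator`. -/
lemma InfluenceClasses.generator_graph (C : InfluenceClasses d) (q : I) :
    (C.generator q).graph = C.generatorGraph q :=
  Submodule.toLinearPMap_graph_eq _ (C.generatorGraph_functional q)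

/-! ### Simple eigenvalues and the ergodicity threshold -/

/-- The eigenspace `{f ∈ Dom(A) : A f = t f}` of an unbounded operator `A`. -/
def eigenspace {E : Type*} [AddCommGroup E] [Module ℝ E] (A : E →ₗ.[ℝ] E) (t : ℝ) :
    Submodule ℝ E :=
  (LinearMap.ker (A.toFun - t • A.domain.subtype)).map A.domain.subtype

/-- `t` is a simple eigenvalue of `A`: its eigenspace is one-dimensional. -/
def IsSimpleEigenvalue {E : Type*} [AddCommGroup E] [Module ℝ E] (A : E →ₗ.[ℝ] E) (t : ℝ) :
    Prop :=
  Module.finrank ℝ (eigenspace A t) = 1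

/-- The ergodicity threshold `q_c = inf {q ∈ (0,1] : 0 is a simple eigenvalue of ℒ}`. The value
`q = 0` is excluded: there `μ` is a point mass, `L²(μ)` is one-dimensional, and `0` is a simple
eigenvalue of `ℒ` for every choice of the constraints. -/
def InfluenceClasses.qc (C : InfluenceClasses d) : ℝ :=
  sInf {q : ℝ | ∃ h : q ∈ Set.Icc (0 : ℝ) 1, 0 < q ∧ IsSimpleEigenvalue (C.generator ⟨q, h⟩) 0}

end KCSM

end

/-! For `0 < q` the eigenvalue `0` is simple exactly when bootstrap percolation almost surely
empties the origin (`isSimpleEigenvalue_iff_empties`). The bridge is that kernel elements have zero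
Dirichlet form, so almost surely they do not change under legal flips, that is, flips at sites where
the constraint holds.

If `0` is simple: the event that the origin is eventually emptied is itself invariant under legal
flips (`emptied_update`), so its indicator lies in the kernel and is almost surely constant. The
event contains `{η 0 = 0}`, which has probability `q > 0`, so the constant is `1`.

If the origin is almost surely emptied: by translation invariance every site is, and by finite range
each emptying is achieved by a finite list of legal flips. Take two configurations that differ only
at `x`. A legal list that empties `x` from the one where `x` is occupied is also legal from the
other, and both end in the same configuration. A kernel element therefore takes the same value at
both (`Empties.ae_resample`). So it depends on no single coordinate, and a zero-one law makes it
constant (`ae_eq_const_of_resample`).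

A monotone coupling shows that `Empties` is increasing in `q` (`Empties.mono`). The two thresholds
are then infima of sets that differ at most in the point `0`, and every `q` above the common value
satisfies `Empties`. -/

namespace KCSM

variable {d : ℕ}

/-! ### The bootstrap dynamics -/

namespace InfluenceClasses

lemma satisfied_mono (C : InfluenceClasses d) {x : Site d} {η ξ : Config d}
    (h : ∀ y, η y = 0 → ξ y = 0) (hx : C.Satisfied x η) : C.Satisfied x ξ := by
  obtain ⟨A, hA, h0⟩ := hx
  exact ⟨A, hA, fun y hy => h y (h0 y hy)⟩

lemma satisfied_update (C : InfluenceClasses d) (x : Site d) (η : Config d) (s : Fin 2) :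
    C.Satisfied x (Function.update η x s) ↔ C.Satisfied x η := by
  refine exists_congr fun A => and_congr_right fun hA => forall₂_congr fun y hy => ?_
  have hyx : y ≠ x := fun h => C.notMem_self x A hA (h ▸ hy)
  rw [Function.update_of_ne hyx]

lemma bootstrap_eq_zero_iff (C : InfluenceClasses d) (η : Config d) (x : Site d) :
    C.bootstrap η x = 0 ↔ η x = 0 ∨ C.Satisfied x η := by
  unfold bootstrap
  split_ifs with h <;> simp [h]

lemma bootstrap_mono (C : InfluenceClasses d) {η ξ : Config d} (h : ∀ y, η y = 0 → ξ y = 0)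
    (x : Site d) (hx : C.bootstrap η x = 0) : C.bootstrap ξ x = 0 := by
  rw [bootstrap_eq_zero_iff] at hx ⊢
  exact hx.imp (h x) (C.satisfied_mono h)

lemma iterate_bootstrap_mono (C : InfluenceClasses d) (n : ℕ) {η ξ : Config d}
    (h : ∀ y, η y = 0 → ξ y = 0) : ∀ x, C.bootstrap^[n] η x = 0 → C.bootstrap^[n] ξ x = 0 := by
  induction n with
  | zero => exact h
  | succ n ih =>
    intro x
    rw [Function.iterate_succ_apply', Function.iterate_succ_apply']
    exact C.bootstrap_mono ih x

lemma iterate_bootstrap_eq_zero_of_le (C : InfluenceClasses d) {η : Config d} {x : Site d}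
    {m n : ℕ} (hmn : m ≤ n) (h : C.bootstrap^[m] η x = 0) : C.bootstrap^[n] η x = 0 := by
  induction n, hmn using Nat.le_induction with
  | base => exact h
  | succ n _ ih =>
    rw [Function.iterate_succ_apply', bootstrap_eq_zero_iff]
    exact Or.inl ih

/-- The bootstrap dynamics started from `η` eventually empties the site `x`. -/
def Emptied (C : InfluenceClasses d) (x : Site d) (η : Config d) : Prop :=
  ∃ n, C.bootstrap^[n] η x = 0

lemma measurable_iterate_bootstrap_apply (C : InfluenceClasses d) (n : ℕ) (x : Site d) :
    Measurable fun η : Config d => C.bootstrap^[n] η x :=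
  (measurable_pi_apply x).comp (C.measurable_bootstrap.iterate n)

lemma measurableSet_emptied (C : InfluenceClasses d) (x : Site d) :
    MeasurableSet {η | C.Emptied x η} := by
  simp only [Emptied, Set.ofPred_exists]
  exact MeasurableSet.iUnion fun n =>
    C.measurable_iterate_bootstrap_apply n x (measurableSet_singleton 0)

lemma emptied_mono (C : InfluenceClasses d) {x : Site d} {η ξ : Config d}
    (h : ∀ y, η y = 0 → ξ y = 0) (hx : C.Emptied x η) : C.Emptied x ξ :=
  hx.imp fun n hn => C.iterate_bootstrap_mono n h x hn

/-- A legal flip does not change the set of sites which are eventually emptied. -/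
lemma emptied_update (C : InfluenceClasses d) {x : Site d} {η : Config d} (hx : C.Satisfied x η)
    (s : Fin 2) (y : Site d) : C.Emptied y (Function.update η x s) ↔ C.Emptied y η := by
  -- One bootstrap step from `ζ` empties `x`, after which every empty site of `ξ` is empty. This
  -- costs one unit of time, hence `n + 1`.
  have key : ∀ {ξ ζ : Config d}, C.Satisfied x ζ → (∀ z ≠ x, ξ z = ζ z) →
      C.Emptied y ξ → C.Emptied y ζ := by
    rintro ξ ζ hζ hξ ⟨n, hn⟩
    refine ⟨n + 1, ?_⟩
    rw [Function.iterate_succ_apply]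
    refine C.iterate_bootstrap_mono n (fun z hz => ?_) y hn
    rw [bootstrap_eq_zero_iff]
    by_cases hzx : z = x
    · exact Or.inr (hzx ▸ hζ)
    · exact Or.inl (hξ z hzx ▸ hz)
  exact ⟨key hx fun z hz => Function.update_of_ne hz _ _,
    key ((C.satisfied_update x η s).2 hx) fun z hz => (Function.update_of_ne hz _ _).symm⟩

/-! ### Weak convergence of the bootstrap laws -/

open Classical in
/-- The limit `T^∞(η)` of the bootstrap dynamics started from `η`. -/
noncomputable def bootstrapLimit (C : InfluenceClasses d) (η : Config d) : Config d :=
  fun x => if C.Emptied x η then 0 else 1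

lemma measurable_bootstrapLimit (C : InfluenceClasses d) : Measurable C.bootstrapLimit :=
  measurable_pi_lambda _ fun x =>
    Measurable.ite (C.measurableSet_emptied x) measurable_const measurable_const

/-- Empty sites stay empty, so each coordinate is eventually constant, which is convergence in the
product topology. -/
lemma tendsto_iterate_bootstrap (C : InfluenceClasses d) (η : Config d) :
    Tendsto (fun n => C.bootstrap^[n] η) atTop (𝓝 (C.bootstrapLimit η)) := by
  refine tendsto_pi_nhds.2 fun x => tendsto_nhds_of_eventually_eq ?_
  by_cases hx : C.Emptied x η
  · obtain ⟨n, hn⟩ := hx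
    filter_upwards [eventually_ge_atTop n] with m hm
    rw [C.iterate_bootstrap_eq_zero_of_le hm hn, bootstrapLimit, if_pos ⟨n, hn⟩]
  · refine Eventually.of_forall fun n => ?_
    rw [bootstrapLimit, if_neg hx]
    have : C.bootstrap^[n] η x ≠ 0 := fun h => hx ⟨n, h⟩
    omega

/-- The law `μ^{(∞)}` of `T^∞(η)`. -/
noncomputable def limitLaw (C : InfluenceClasses d) (q : I) : ProbabilityMeasure (Config d) :=
  ProbabilityMeasure.map ⟨prodLaw d q, inferInstance⟩ C.measurable_bootstrapLimit.aemeasurable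

lemma tendsto_bootstrapLaw (C : InfluenceClasses d) (q : I) :
    Tendsto (fun n => C.bootstrapLaw q n) atTop (𝓝 (C.limitLaw q)) := by
  rw [ProbabilityMeasure.tendsto_iff_forall_integral_tendsto]
  intro f
  have hf : ∀ μ : Measure (Config d), AEStronglyMeasurable f μ := fun μ =>
    f.continuous.measurable.aestronglyMeasurable
  have h1 : ∀ n, ∫ η, f η ∂(C.bootstrapLaw q n : Measure (Config d))
      = ∫ η, f (C.bootstrap^[n] η) ∂(prodLaw d q) := fun n =>
    integral_map (C.measurable_bootstrap.iterate n).aemeasurable (hf _)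
  have h2 : ∫ η, f η ∂(C.limitLaw q : Measure (Config d))
      = ∫ η, f (C.bootstrapLimit η) ∂(prodLaw d q) :=
    integral_map C.measurable_bootstrapLimit.aemeasurable (hf _)
  simp only [h1, h2]
  refine tendsto_integral_of_dominated_convergence (fun _ => ‖f‖)
    (fun n => (f.continuous.measurable.comp
      (C.measurable_bootstrap.iterate n)).aestronglyMeasurable) (integrable_const _)
    (fun n => ae_of_all _ fun η => f.norm_coe_le_norm _) (ae_of_all _ fun η => ?_)
  exact (f.continuous.tendsto _).comp (C.tendsto_iterate_bootstrap η)

/-- `μ^{(∞)}(η_0 = 0) = 1` iff almost surely the origin is eventually emptied. -/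
lemma empties_iff (C : InfluenceClasses d) (q : I) :
    C.Empties q ↔ ∀ᵐ η ∂(prodLaw d q), C.Emptied 0 η := by
  have hm : MeasurableSet {η : Config d | η 0 = 0} :=
    measurable_pi_apply (0 : Site d) (measurableSet_singleton 0)
  have hl : (C.limitLaw q : Measure (Config d)) {η | η 0 = 0}
      = prodLaw d q {η | C.Emptied 0 η} := by
    refine (Measure.map_apply C.measurable_bootstrapLimit hm).trans (congrArg _ ?_)
    ext η
    by_cases h : C.Emptied 0 η <;> simp [bootstrapLimit, h]
  have hp := prob_compl_eq_zero_iff (μ := prodLaw d q) (C.measurableSet_emptied 0)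
  rw [ae_iff, ← Set.compl_ofPred, hp, ← hl]
  constructor
  · rintro ⟨m, h1, h2⟩
    -- `Empties` only asserts that some weak limit exists; uniqueness identifies it with `limitLaw`.
    rwa [tendsto_nhds_unique (C.tendsto_bootstrapLaw q) h1]
  · exact fun h => ⟨_, C.tendsto_bootstrapLaw q, h⟩

/-! ### Translation invariance -/

lemma satisfied_shift (C : InfluenceClasses d) (x y : Site d) (η : Config d) :
    C.Satisfied y (fun z => η (z + x)) ↔ C.Satisfied (y + x) η := by
  unfold Satisfied
  rw [C.translate y, C.translate (y + x)]
  simp only [Set.exists_mem_image, Set.forall_mem_image, add_assoc]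

lemma iterate_bootstrap_shift (C : InfluenceClasses d) (n : ℕ) (x : Site d) (η : Config d) :
    ∀ y, C.bootstrap^[n] (fun z => η (z + x)) y = C.bootstrap^[n] η (y + x) := by
  induction n with
  | zero => exact fun y => rfl
  | succ n ih =>
    intro y
    rw [Function.iterate_succ_apply', Function.iterate_succ_apply', funext ih]
    classical exact if_congr (or_congr_right (C.satisfied_shift x y _)) rfl rfl

lemma emptied_shift (C : InfluenceClasses d) (x y : Site d) (η : Config d) :
    C.Emptied y (fun z => η (z + x)) ↔ C.Emptied (y + x) η := by
  simp only [Emptied, C.iterate_bootstrap_shift]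

end InfluenceClasses

lemma measurePreserving_shift (q : I) (x : Site d) :
    MeasurePreserving (fun (η : Config d) z => η (z + x)) (prodLaw d q) (prodLaw d q) := by
  refine ⟨measurable_pi_lambda _ fun z => measurable_pi_apply _, ?_⟩
  have h := Measure.infinitePi_map_piCongrLeft (X := fun _ : Site d => Fin 2)
    (μ := fun _ : Site d => siteLaw q) (Equiv.subRight x)
  unfold prodLaw
  convert h using 2
  funext η z
  have := (Equiv.piCongrLeft_apply_apply (fun _ : Site d => Fin 2) (Equiv.subRight x) η (z + x))
  rw [MeasurableEquiv.coe_piCongrLeft]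
  simpa using this.symm

lemma InfluenceClasses.Empties.ae_forall_emptied {C : InfluenceClasses d} {q : I}
    (h : C.Empties q) : ∀ᵐ η ∂(prodLaw d q), ∀ x, C.Emptied x η := by
  rw [C.empties_iff] at h
  refine ae_all_iff.2 fun x => ?_
  filter_upwards [(measurePreserving_shift q x).quasiMeasurePreserving.ae h] with η hη
  simpa [C.emptied_shift] using hη

/-! ### Monotonicity in the parameter -/

/-- The monotone coupling of the laws `siteLaw q`: a uniform variable `u` is sent to `0` iff
`u < q`. -/
noncomputable def threshold (q u : I) : Fin 2 := if u < q then 0 else 1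

lemma measurable_threshold (q : I) : Measurable (threshold q) :=
  Measurable.ite measurableSet_Iio measurable_const measurable_const

lemma map_threshold (q : I) : (volume : Measure I).map (threshold q) = siteLaw q := by
  refine Measure.ext_of_singleton fun a => ?_
  rw [Measure.map_apply (measurable_threshold q) (measurableSet_singleton a)]
  fin_cases a
  · have : threshold q ⁻¹' {0} = Set.Iio q := by ext u; simp [threshold]
    simp only [Fin.zero_eta, this, unitInterval.volume_Iio, siteLaw]
    rw [bernoulliMeasure_apply_of_mem_of_notMem _ (by simp) (by simp)]
    · simp [ENNReal.ofReal, unitInterval.toNNReal, Real.toNNReal_of_nonneg q.2.1]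
      rfl
    · simp
  · have : threshold q ⁻¹' {1} = Set.Ici q := by ext u; simp [threshold]
    simp only [Fin.mk_one, this, unitInterval.volume_Ici, siteLaw]
    rw [bernoulliMeasure_apply_of_notMem_of_mem _ (by simp) (by simp)]
    · have h := (unitInterval.symm q).2.1
      simp only [unitInterval.coe_symm_eq] at h
      simp [ENNReal.ofReal, unitInterval.toNNReal, Real.toNNReal_of_nonneg h]
      rfl
    · simp

lemma measurePreserving_threshold (d : ℕ) (q : I) :
    MeasurePreserving (fun (u : Site d → I) x => threshold q (u x))
      (Measure.infinitePi fun _ : Site d => (volume : Measure I)) (prodLaw d q) := by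
  refine ⟨measurable_pi_lambda _ fun x =>
    (measurable_threshold q).comp (measurable_pi_apply x), ?_⟩
  rw [Measure.infinitePi_map_pi _ fun _ => measurable_threshold q]
  simp only [map_threshold]
  rfl

/-- Drive both parameters by the same uniform variables: every site empty at level `q` is empty at
level `q'`, and the dynamics is monotone. -/
lemma InfluenceClasses.Empties.mono {C : InfluenceClasses d} {q q' : I} (h : C.Empties q)
    (hq : q ≤ q') : C.Empties q' := by
  rw [C.empties_iff] at h ⊢
  have h' := (measurePreserving_threshold d q).quasiMeasurePreserving.ae h
  rw [← (measurePreserving_threshold d q').map_eq,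
    ae_map_iff (measurePreserving_threshold d q').measurable.aemeasurable
      (C.measurableSet_emptied 0)]
  filter_upwards [h'] with u hu
  refine C.emptied_mono (fun y hy => ?_) hu
  simp only [threshold] at hy ⊢
  have hy' : u y < q := by by_contra hlt; simp [hlt] at hy
  rw [if_pos (hy'.trans_le hq)]

lemma InfluenceClasses.empties_one (C : InfluenceClasses d) : C.Empties 1 := by
  rw [C.empties_iff]
  have : prodLaw d 1 = Measure.dirac fun _ => 0 := by
    simp [prodLaw, siteLaw, Measure.infinitePi_dirac]
  rw [this]
  exact (ae_dirac_iff (C.measurableSet_emptied 0)).2 ⟨0, rfl⟩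

/-! ### A zero-one law for functions which depend on no single coordinate -/

/-- Independence of `f` from finite boxes, one coordinate at a time: resampling at `x` leaves `f`
unchanged while it decouples the condition at `x` from the rest. -/
lemma setIntegral_box_of_resample {q : I} {f : Config d → ℝ} (hfm : Measurable f)
    (hf : ∀ x, ∀ᵐ p ∂((prodLaw d q).prod (siteLaw q)), f (Function.update p.1 x p.2) = f p.1)
    {t : Site d → Set (Fin 2)} (ht : ∀ x, MeasurableSet (t x)) (Λ : Finset (Site d)) :
    ∫ η in (Λ : Set (Site d)).pi t, f η ∂(prodLaw d q)
      = (prodLaw d q).real ((Λ : Set (Site d)).pi t) * ∫ η, f η ∂(prodLaw d q) := by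
  classical
  have hbox : ∀ Λ : Finset (Site d), MeasurableSet ((Λ : Set (Site d)).pi t) := fun Λ =>
    MeasurableSet.pi Λ.countable_toSet fun x _ => ht x
  have hreal : ∀ Λ : Finset (Site d), (prodLaw d q).real ((Λ : Set (Site d)).pi t)
      = ∏ x ∈ Λ, (siteLaw q).real (t x) := fun Λ => by
    rw [measureReal_def, prodLaw, Measure.infinitePi_pi _ (fun x _ => ht x), ENNReal.toReal_prod]
    rfl
  rw [hreal]
  induction Λ using Finset.induction_on with
  | empty => simp
  | insert x Λ hx ih =>
    have hmp := measurePreserving_update q x (d := d)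
    rw [Finset.prod_insert hx, mul_assoc, ← ih, ← integral_indicator (hbox _),
      ← integral_indicator (hbox _)]
    have hg : Measurable (((insert x Λ : Finset (Site d)) : Set (Site d)).pi t |>.indicator f) :=
      hfm.indicator (hbox _)
    -- With `μ` written as the law of the resampled configuration, the value at `x` is an
    -- independent draw and the integral factorises.
    rw [← hmp.map_eq, integral_map hmp.measurable.aemeasurable hg.aestronglyMeasurable,
      hmp.map_eq, mul_comm, ← integral_indicator_one (ht x), ← integral_prod_mul]
    refine integral_congr_ae ?_
    filter_upwards [hf x] with p hp
    have hiff : Function.update p.1 x p.2 ∈ ((insert x Λ : Finset (Site d)) : Set (Site d)).pi t ↔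
        p.1 ∈ (Λ : Set (Site d)).pi t ∧ p.2 ∈ t x := by
      simp only [Set.mem_pi, Finset.mem_coe, Finset.forall_mem_insert, Function.update_self]
      rw [and_comm]
      refine and_congr_left fun _ => forall₂_congr fun y hy => ?_
      rw [Function.update_of_ne (ne_of_mem_of_not_mem hy hx)]
    by_cases h1 : p.1 ∈ (Λ : Set (Site d)).pi t <;> by_cases h2 : p.2 ∈ t x <;>
      simp only [Set.indicator, hiff, h1, h2, hp] <;> simp

/-- Boxes form a π-system that generates the σ-algebra, so `f` and its mean have the same integral
over every measurable set. -/
lemma ae_eq_const_of_resample {q : I} {f : Config d → ℝ} (hfm : Measurable f)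
    (hfi : Integrable f (prodLaw d q))
    (hf : ∀ x, ∀ᵐ p ∂((prodLaw d q).prod (siteLaw q)), f (Function.update p.1 x p.2) = f p.1) :
    ∃ c : ℝ, f =ᵐ[prodLaw d q] fun _ => c := by
  set c := ∫ η, f η ∂(prodLaw d q) with hc
  have hset : ∀ A, MeasurableSet A →
      ∫ η in A, f η ∂(prodLaw d q) = (prodLaw d q).real A * c := by
    intro A hA
    induction A, hA using MeasurableSpace.induction_on_inter
      generateFrom_squareCylinders.symm
      (isPiSystem_squareCylinders (fun _ => MeasurableSpace.isPiSystem_measurableSet)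
        (by simp)) with
    | empty => simp
    | basic A hA =>
      obtain ⟨Λ, t, ht, rfl⟩ := hA
      exact setIntegral_box_of_resample hfm hf (fun x => ht x (Set.mem_univ x)) Λ
    | compl A hA ih =>
      have h1 := integral_add_compl hA hfi
      rw [probReal_compl_eq_one_sub hA]
      linarith
    | iUnion A hd hA ih =>
      rw [integral_iUnion hA hd hfi.integrableOn, measureReal_def, measure_iUnion hd hA,
        ENNReal.tsum_toReal_eq fun n => measure_ne_top _ _, ← tsum_mul_right]
      exact tsum_congr ih
  refine ⟨c, ?_⟩
  have h0 := (hfi.sub (integrable_const c)).ae_eq_zero_of_forall_setIntegral_eq_zero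
    fun A hA _ => by
      simp only [Pi.sub_apply]
      rw [integral_sub hfi.integrableOn (integrable_const c).integrableOn, hset A hA,
        setIntegral_const, smul_eq_mul, sub_self]
  filter_upwards [h0] with η hη
  simpa [sub_eq_zero] using hη

/-! ### Emptying finitely many sites -/

lemma eq_of_ae_siteLaw {q : I} (hq : 0 < q) {P : Fin 2 → Prop} (h : ∀ᵐ s ∂(siteLaw q), P s) :
    P 0 := by
  by_contra h0
  have h1 : siteLaw q {0} = 0 := measure_mono_null (by simpa using h0) (ae_iff.1 h)
  rw [siteLaw, bernoulliMeasure_apply_of_mem_of_notMem _ (measurableSet_singleton 0) (by simp)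
    (by simp), ENNReal.coe_eq_zero] at h1
  exact hq.ne' (Subtype.ext (congrArg NNReal.toReal h1))

/-- Resampling preserves `μ` and draws `0` with probability `q > 0`, so emptying a site cannot
charge a null set. Filling a site may fail this when `q = 1`, which is why all moves below are
emptyings. -/
lemma quasiMeasurePreserving_update_zero {q : I} (hq : 0 < q) (x : Site d) :
    Measure.QuasiMeasurePreserving (fun η : Config d => Function.update η x 0)
      (prodLaw d q) (prodLaw d q) := by
  have hm : Measurable fun η : Config d => Function.update η x 0 :=
    (measurePreserving_update q x).measurable.comp (measurable_id.prodMk measurable_const)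
  refine ⟨hm, Measure.AbsolutelyContinuous.mk fun A hA h0 => ?_⟩
  rw [Measure.map_apply hm hA, measure_eq_zero_iff_ae_notMem]
  rw [measure_eq_zero_iff_ae_notMem] at h0
  have h1 := Measure.ae_ae_of_ae_prod ((measurePreserving_update q x).quasiMeasurePreserving.ae h0)
  filter_upwards [h1] with η hη
  exact eq_of_ae_siteLaw hq hη

/-- Empty the sites of a list one after the other. -/
def zeroOut : List (Site d) → Config d → Config d
  | [], η => η
  | x :: l, η => zeroOut l (Function.update η x 0)

lemma zeroOut_append (l l' : List (Site d)) (η : Config d) :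
    zeroOut (l ++ l') η = zeroOut l' (zeroOut l η) := by
  induction l generalizing η with
  | nil => rfl
  | cons x l ih => exact ih _

lemma zeroOut_of_mem {l : List (Site d)} {x : Site d} (hx : x ∈ l) (η : Config d) :
    zeroOut l η x = 0 := by
  have hz : ∀ (l : List (Site d)) (η : Config d), η x = 0 → zeroOut l η x = 0 := by
    intro l
    induction l with
    | nil => exact fun η h => h
    | cons y l ih =>
      intro η h
      refine ih _ ?_
      by_cases hxy : x = y
      · subst hxy; simp
      · rwa [Function.update_of_ne hxy]
  induction l generalizing η with
  | nil => simp at hx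
  | cons y l ih =>
    rcases List.mem_cons.1 hx with rfl | h
    · exact hz l _ (by simp)
    · exact ih h _

lemma zeroOut_of_notMem {l : List (Site d)} {x : Site d} (hx : x ∉ l) (η : Config d) :
    zeroOut l η x = η x := by
  induction l generalizing η with
  | nil => rfl
  | cons y l ih =>
    rw [List.mem_cons, not_or] at hx
    rw [zeroOut, ih hx.2, Function.update_of_ne hx.1]

/-- Emptying a list forgets the initial values on it. This is how two configurations that differ at
`x` are merged. -/
lemma zeroOut_update {l : List (Site d)} {x : Site d} (hx : x ∈ l) (η : Config d) (s : Fin 2) :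
    zeroOut l (Function.update η x s) = zeroOut l η := by
  funext y
  by_cases hy : y ∈ l
  · rw [zeroOut_of_mem hy, zeroOut_of_mem hy]
  · rw [zeroOut_of_notMem hy, zeroOut_of_notMem hy,
      Function.update_of_ne (ne_of_mem_of_not_mem hx hy).symm]

lemma quasiMeasurePreserving_zeroOut {q : I} (hq : 0 < q) (l : List (Site d)) :
    Measure.QuasiMeasurePreserving (zeroOut l) (prodLaw d q) (prodLaw d q) := by
  induction l with
  | nil => exact Measure.QuasiMeasurePreserving.id _
  | cons x l ih => exact ih.comp (quasiMeasurePreserving_update_zero hq x)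

namespace InfluenceClasses

/-- Starting from `η`, each site of the list may be emptied in turn, the constraint being
satisfied at that moment. -/
def Legal (C : InfluenceClasses d) : List (Site d) → Config d → Prop
  | [], _ => True
  | x :: l, η => C.Satisfied x η ∧ Legal C l (Function.update η x 0)

lemma Legal.mono {C : InfluenceClasses d} {l : List (Site d)} {η ξ : Config d}
    (hl : C.Legal l η) (h : ∀ y, η y = 0 → ξ y = 0) : C.Legal l ξ := by
  induction l generalizing η ξ with
  | nil => trivial
  | cons x l ih =>
    refine ⟨C.satisfied_mono h hl.1, ih hl.2 fun y => ?_⟩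
    by_cases hyx : y = x
    · subst hyx; simp
    · simpa [Function.update_of_ne hyx] using h y

lemma Legal.append {C : InfluenceClasses d} {l l' : List (Site d)} {η : Config d}
    (hl : C.Legal l η) (hl' : C.Legal l' (zeroOut l η)) : C.Legal (l ++ l') η := by
  induction l generalizing η with
  | nil => exact hl'
  | cons x l ih => exact ⟨hl.1, ih hl.2 hl'⟩

/-- Legal lists for finitely many sites may be concatenated. -/
lemma exists_legal_of_finite (C : InfluenceClasses d) {η : Config d} {A : Set (Site d)}
    (hA : A.Finite) (h : ∀ y ∈ A, ∃ l, C.Legal l η ∧ zeroOut l η y = 0) :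
    ∃ l, C.Legal l η ∧ ∀ y ∈ A, zeroOut l η y = 0 := by
  have hmono : ∀ (l : List (Site d)) (ξ : Config d) y, ξ y = 0 → zeroOut l ξ y = 0 := by
    intro l ξ y hy
    by_cases hyl : y ∈ l
    · exact zeroOut_of_mem hyl ξ
    · rw [zeroOut_of_notMem hyl, hy]
  induction A, hA using Set.Finite.induction_on with
  | empty => exact ⟨[], trivial, by simp⟩
  | @insert x A _ _ ih =>
    obtain ⟨l, hl, h0⟩ := ih fun y hy => h y (Set.mem_insert_of_mem x hy)
    obtain ⟨l', hl', h0'⟩ := h x (Set.mem_insert x A)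
    -- Performing `l'` before `l` only adds empty sites, which keeps `l` legal.
    refine ⟨l' ++ l, hl'.append (hl.mono (hmono l' η)), ?_⟩
    rintro y (rfl | hy)
    · rw [zeroOut_append]
      exact hmono _ _ _ h0'
    · by_cases hyl : y ∈ l' ++ l
      · exact zeroOut_of_mem hyl η
      · have hyl' : y ∉ l := fun h => hyl (List.mem_append_right l' h)
        rw [zeroOut_of_notMem hyl, ← zeroOut_of_notMem hyl' η]
        exact h0 y hy

lemma cls_mem_finite (C : InfluenceClasses d) {x : Site d} {A : Set (Site d)}
    (hA : A ∈ C.cls x) : A.Finite := by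
  obtain ⟨r, hr⟩ := C.finite_range
  exact (finite_dist₁_le x r).subset fun y hy => (hr x A hA y hy).2

/-- A parallel bootstrap step becomes sequential: the witnessing set `A` is finite, so finitely many
legal moves empty it, and then `x` may be emptied. -/
lemma exists_legal_of_iterate (C : InfluenceClasses d) (η : Config d) (n : ℕ) :
    ∀ x, C.bootstrap^[n] η x = 0 → ∃ l, C.Legal l η ∧ zeroOut l η x = 0 := by
  induction n with
  | zero => exact fun x hx => ⟨[], trivial, hx⟩
  | succ n ih =>
    intro x hx
    rw [Function.iterate_succ_apply', bootstrap_eq_zero_iff] at hx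
    rcases hx with hx | ⟨A, hA, h0⟩
    · exact ih x hx
    · obtain ⟨l, hl, hl0⟩ := C.exists_legal_of_finite (C.cls_mem_finite hA)
        fun y hy => ih y (h0 y hy)
      exact ⟨l ++ [x], hl.append ⟨⟨A, hA, hl0⟩, trivial⟩, zeroOut_of_mem (by simp) η⟩

/-! ### Functions with zero Dirichlet form -/

lemma ae_eq_update_zero (C : InfluenceClasses d) {q : I} (hq : 0 < q) {f : Config d → ℝ}
    (hfm : Measurable f) {x : Site d}
    (hf : ∀ᵐ η ∂(prodLaw d q), C.rate x η * localVar q x f η = 0) :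
    ∀ᵐ η ∂(prodLaw d q), C.Satisfied x η → f (Function.update η x 0) = f η := by
  have hmp := measurePreserving_update q x (d := d)
  have hms : MeasurableSet
      {η : Config d | C.Satisfied x η → f (Function.update η x 0) = f η} := by
    have h1 : {η : Config d | C.Satisfied x η → f (Function.update η x 0) = f η}
        = {η | C.Satisfied x η}ᶜ ∪ {η | f (Function.update η x 0) = f η} := by
      ext η
      simp [imp_iff_not_or]
    rw [h1]
    exact (C.measurableSet_satisfied x).compl.union (measurableSet_eq_fun
      (hfm.comp (quasiMeasurePreserving_update_zero hq x).measurable) hfm)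
  -- A typical configuration is viewed as a resampled one, so that zero variance in the resampled
  -- variable can be used for almost every value. The value at `0` equals the local mean because `0`
  -- has positive mass.
  rw [← hmp.map_eq, ae_map_iff hmp.measurable.aemeasurable hms]
  have hms' := hmp.measurable hms
  refine (Measure.ae_prod_iff_ae_ae hms').2 ?_
  filter_upwards [hf] with η hη
  by_cases hs : C.Satisfied x η
  · have hv : localVar q x f η = 0 := by simpa [rate, hs] using hη
    have hae := ae_eq_integral_of_variance_eq_zero (memLp_fin q _) hv
    have h0 := eq_of_ae_siteLaw hq hae
    filter_upwards [hae] with s hs' _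
    rw [Function.update_idem, h0, hs']
  · exact ae_of_all _ fun s h => absurd ((C.satisfied_update x η s).1 h) hs

/-- There are countably many lists and each `zeroOut l` is nonsingular, so one null set serves for
all intermediate configurations. -/
lemma ae_eq_zeroOut (C : InfluenceClasses d) {q : I} (hq : 0 < q) {f : Config d → ℝ}
    (hf : ∀ x, ∀ᵐ η ∂(prodLaw d q), C.Satisfied x η → f (Function.update η x 0) = f η) :
    ∀ᵐ η ∂(prodLaw d q), ∀ l, C.Legal l η → f (zeroOut l η) = f η := by
  rw [← ae_all_iff] at hf
  have h : ∀ᵐ η ∂(prodLaw d q), ∀ l : List (Site d), ∀ x, C.Satisfied x (zeroOut l η) →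
      f (Function.update (zeroOut l η) x 0) = f (zeroOut l η) :=
    ae_all_iff.2 fun l => (quasiMeasurePreserving_zeroOut hq l).ae hf
  filter_upwards [h] with η hη l hl
  induction l generalizing η with
  | nil => rfl
  | cons x l ih =>
    rw [zeroOut, ih _ (fun l' => hη (x :: l')) hl.2]
    exact hη [] x hl.1

lemma Empties.ae_resample {C : InfluenceClasses d} {q : I} (hC : C.Empties q) (hq : 0 < q)
    {f : Config d → ℝ}
    (hf : ∀ x, ∀ᵐ η ∂(prodLaw d q), C.Satisfied x η → f (Function.update η x 0) = f η)
    (x : Site d) : ∀ᵐ p ∂((prodLaw d q).prod (siteLaw q)),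
      f (Function.update p.1 x p.2) = f p.1 := by
  have hgood := hC.ae_forall_emptied.and (C.ae_eq_zeroOut hq hf)
  filter_upwards [(measurePreserving_update q x).quasiMeasurePreserving.ae hgood,
    Measure.quasiMeasurePreserving_fst.ae hgood] with ⟨η, s⟩ h1 h2
  simp only at h1 h2 ⊢
  -- Here `x` is occupied in `ξ` and empty in `ζ`. A legal list that empties `x` from `ξ` must
  -- contain `x`; it is legal from `ζ` by monotonicity and leads to the same final configuration.
  have key : ∀ {ξ ζ : Config d}, (∃ a, ζ = Function.update ξ x a) → ξ x ≠ 0 → ζ x = 0 →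
      C.Emptied x ξ → (∀ l, C.Legal l ξ → f (zeroOut l ξ) = f ξ) →
      (∀ l, C.Legal l ζ → f (zeroOut l ζ) = f ζ) → f ζ = f ξ := by
    rintro ξ ζ ⟨a, rfl⟩ hξ hζ ⟨n, hn⟩ hfξ hfζ
    obtain ⟨l, hl, hl0⟩ := C.exists_legal_of_iterate ξ n x hn
    have hxl : x ∈ l := by
      by_contra hxl
      exact hξ (zeroOut_of_notMem hxl ξ ▸ hl0)
    rw [← hfξ l hl, ← hfζ l (hl.mono fun y hy => ?_), zeroOut_update hxl]
    have hyx : y ≠ x := by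
      rintro rfl
      exact hξ hy
    rwa [Function.update_of_ne hyx]
  by_cases hs : η x = s
  · rw [← hs, Function.update_eq_self]
  by_cases h0 : η x = 0
  · have hs0 : s ≠ 0 := fun h => hs (h0.trans h.symm)
    refine (key ⟨η x, by simp⟩ (by simpa using hs0) h0 (h1.1 x) h1.2 h2.2).symm
  · have hs0 : s = 0 := by omega
    exact key ⟨s, rfl⟩ h0 (by simpa using hs0) (h2.1 x) h2.2 h1.2

/-! ### The kernel of the generator -/

lemma mem_eigenspace_zero_iff (C : InfluenceClasses d) (q : I) (f : L2 d q) :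
    f ∈ eigenspace (C.generator q) 0 ↔ (f, 0) ∈ C.generatorGraph q := by
  rw [← C.generator_graph, LinearPMap.mem_graph_iff]
  simp only [eigenspace, zero_smul, sub_zero, Submodule.mem_map, LinearMap.mem_ker,
    Submodule.subtype_apply]
  exact exists_congr fun y => and_comm

/-- A square integrable function which is invariant under legal flips is in the kernel. -/
lemma mem_eigenspace_of_invariant (C : InfluenceClasses d) (q : I) {f : Config d → ℝ}
    (hf : MemLp f 2 (prodLaw d q))
    (h : ∀ x η s, C.Satisfied x η → f (Function.update η x s) = f η) :
    hf.toLp f ∈ eigenspace (C.generator q) 0 := by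
  have hcov : ∀ x (g : Config d → ℝ) η, C.rate x η * localCov q x f g η = 0 := by
    intro x g η
    by_cases hs : C.Satisfied x η
    · have : (fun s => f (Function.update η x s)) = fun _ => f η := funext fun s => h x η s hs
      rw [localCov, this, covariance_const_left, mul_zero]
    · simp [rate, hs]
  rw [C.mem_eigenspace_zero_iff]
  refine ⟨?_, fun g _ => ?_⟩
  · change C.dirichlet q _ ≠ ∞
    rw [C.dirichlet_congr hf.coeFn_toLp]
    simp [dirichlet, localVar_eq, hcov]
  · have h0 : ∀ x, C.dirichletTerm q x (hf.toLp f) g = 0 := fun x => by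
      rw [C.dirichletTerm_congr x hf.coeFn_toLp (ae_eq_refl _)]
      simp [dirichletTerm, hcov]
    simp only [h0, inner_zero_left, neg_zero]
    exact hasSum_zero

/-- Testing the kernel equation against `f` itself gives a vanishing sum of nonnegative terms. -/
lemma ae_rate_mul_localVar_eq_zero (C : InfluenceClasses d) {q : I} {f : L2 d q}
    (hf : f ∈ eigenspace (C.generator q) 0) (x : Site d) :
    ∀ᵐ η ∂(prodLaw d q), C.rate x η * localVar q x f η = 0 := by
  rw [C.mem_eigenspace_zero_iff] at hf
  have hsum := hf.2 f hf.1
  simp only [inner_zero_left, neg_zero] at hsum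
  have hnn : ∀ y η, 0 ≤ C.rate y η * localCov q y f f η := fun y η => by
    rw [← localVar_eq]
    exact mul_nonneg (C.rate_nonneg y η) (localVar_nonneg q y f η)
  have h0 := congrFun ((hasSum_zero_iff_of_nonneg fun y => integral_nonneg (hnn y)).1 hsum) x
  have h1 := (integral_eq_zero_iff_of_nonneg (hnn x)
    (integrable_rate_localCov C x (Lp.memLp f) (Lp.memLp f))).1 h0
  rw [localVar_eq]
  exact h1

lemma toLp_one_ne_zero {q : I} (h : MemLp (fun _ : Config d => (1 : ℝ)) 2 (prodLaw d q)) :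
    h.toLp _ ≠ 0 := by
  intro h0
  have h1 := h.coeFn_toLp
  rw [h0] at h1
  obtain ⟨η, h2, h3⟩ := ((Lp.coeFn_zero ℝ 2 (prodLaw d q)).and h1).exists
  rw [h2] at h3
  exact zero_ne_one h3

lemma Empties.isSimpleEigenvalue {C : InfluenceClasses d} {q : I} (hC : C.Empties q)
    (hq : 0 < q) : IsSimpleEigenvalue (C.generator q) 0 := by
  have hone : MemLp (fun _ : Config d => (1 : ℝ)) 2 (prodLaw d q) := memLp_const 1
  have hspan : eigenspace (C.generator q) 0 = Submodule.span ℝ {hone.toLp _} := by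
    refine le_antisymm (fun f hf => ?_) ?_
    · have hfm : Measurable f := (Lp.stronglyMeasurable f).measurable
      obtain ⟨c, hc⟩ := ae_eq_const_of_resample hfm ((Lp.memLp f).integrable (by norm_num))
        (hC.ae_resample hq fun x => C.ae_eq_update_zero hq hfm
          (C.ae_rate_mul_localVar_eq_zero hf x))
      refine Submodule.mem_span_singleton.2 ⟨c, Lp.ext ?_⟩
      filter_upwards [hc, Lp.coeFn_smul c (hone.toLp _), hone.coeFn_toLp] with η h1 h2 h3
      rw [h1, h2, Pi.smul_apply, h3, smul_eq_mul, mul_one]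
    · rw [Submodule.span_singleton_le_iff_mem]
      exact C.mem_eigenspace_of_invariant q hone fun _ _ _ _ => rfl
  unfold IsSimpleEigenvalue
  rw [hspan]
  exact finrank_span_singleton (toLp_one_ne_zero hone)

lemma empties_of_isSimpleEigenvalue (C : InfluenceClasses d) {q : I} (hq : 0 < q)
    (h : IsSimpleEigenvalue (C.generator q) 0) : C.Empties q := by
  classical
  have hone : MemLp (fun _ : Config d => (1 : ℝ)) 2 (prodLaw d q) := memLp_const 1
  have hms := C.measurableSet_emptied (0 : Site d)
  have hind : MemLp ({η | C.Emptied 0 η}.indicator fun _ : Config d => (1 : ℝ)) 2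
      (prodLaw d q) := hone.indicator hms
  have hind_mem := C.mem_eigenspace_of_invariant q hind fun x η s hs => by
    simp [Set.indicator, C.emptied_update hs]
  have hone_mem := C.mem_eigenspace_of_invariant q hone fun _ _ _ _ => rfl
  obtain ⟨v, -, hv⟩ := finrank_eq_one_iff'.1 h
  obtain ⟨a, ha⟩ := hv ⟨_, hone_mem⟩
  obtain ⟨b, hb⟩ := hv ⟨_, hind_mem⟩
  -- The constant `1` is `a • v` and the indicator is `b • v`, so both sides equal `(a * b) • v`.
  have hab : a • hind.toLp _ = b • hone.toLp _ := by
    have h1 : hone.toLp _ = a • (v : L2 d q) := (congrArg Subtype.val ha).symm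
    have h2 : hind.toLp _ = b • (v : L2 d q) := (congrArg Subtype.val hb).symm
    rw [h1, h2, smul_smul, smul_smul, mul_comm]
  have ha0 : a ≠ 0 := by
    rintro rfl
    rw [zero_smul] at ha
    exact toLp_one_ne_zero hone (congrArg Subtype.val ha).symm
  have hae : ∀ᵐ η ∂(prodLaw d q), a * {η | C.Emptied 0 η}.indicator (fun _ => (1 : ℝ)) η = b := by
    have h1 := Lp.coeFn_smul a (hind.toLp _)
    rw [hab] at h1
    filter_upwards [h1, Lp.coeFn_smul b (hone.toLp _), hone.coeFn_toLp, hind.coeFn_toLp]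
      with η h1 h2 h3 h4
    rw [h2, Pi.smul_apply, Pi.smul_apply, h3, h4] at h1
    simpa using h1.symm
  -- Emptying the origin is nonsingular, so the almost sure identity can be read at a configuration
  -- with `η 0 = 0`. This forces `a = b`; off the event the identity would then give `a = 0`.
  have hempty : ∃ η, C.Emptied 0 η ∧
      a * {η | C.Emptied 0 η}.indicator (fun _ => (1 : ℝ)) η = b := by
    have h1 := (quasiMeasurePreserving_update_zero hq (0 : Site d)).ae hae
    obtain ⟨η, hη⟩ := h1.exists
    exact ⟨_, ⟨0, by simp⟩, hη⟩
  obtain ⟨ξ, hξ, hξb⟩ := hempty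
  have hb' : a = b := by simpa [Set.indicator, hξ] using hξb
  rw [C.empties_iff]
  filter_upwards [hae] with η hη
  by_contra hne
  exact ha0 (by simpa [Set.indicator, hne, ← hb', eq_comm] using hη)

lemma isSimpleEigenvalue_iff_empties (C : InfluenceClasses d) {q : I} (hq : 0 < q) :
    IsSimpleEigenvalue (C.generator q) 0 ↔ C.Empties q :=
  ⟨C.empties_of_isSimpleEigenvalue hq, fun h => h.isSimpleEigenvalue hq⟩

/-! ### Comparison of the two thresholds -/

lemma qbp_le (C : InfluenceClasses d) {q : I} (h : C.Empties q) : C.qbp ≤ q :=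
  csInf_le ⟨0, fun _ hx => hx.1.1⟩ ⟨q.2, h⟩

lemma qc_le (C : InfluenceClasses d) {q : I} (hq : 0 < q) (h : C.Empties q) : C.qc ≤ q :=
  csInf_le ⟨0, fun _ hx => hx.1.1⟩ ⟨q.2, hq, (C.isSimpleEigenvalue_iff_empties hq).2 h⟩

lemma empties_of_qbp_lt (C : InfluenceClasses d) {q : I} (h : C.qbp < q) : C.Empties q := by
  have hne : {q : ℝ | ∃ h : q ∈ Set.Icc (0 : ℝ) 1, C.Empties ⟨q, h⟩}.Nonempty :=
    ⟨(1 : I), (1 : I).2, C.empties_one⟩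
  obtain ⟨p, ⟨hp, hpe⟩, hpq⟩ := exists_lt_of_csInf_lt hne h
  exact hpe.mono hpq.le

lemma qbp_nonneg (C : InfluenceClasses d) : 0 ≤ C.qbp :=
  Real.sInf_nonneg fun _ hx => hx.1.1

lemma qc_eq_qbp (C : InfluenceClasses d) : C.qc = C.qbp := by
  refine le_antisymm (le_of_forall_gt_imp_ge_of_dense fun q (hq : C.qbp < q) => ?_) ?_
  -- Lying strictly above `C.qbp` makes `q` positive, so the exclusion of `q = 0` from the set
  -- defining `C.qc` does no harm.
  · have hq0 : 0 < q := C.qbp_nonneg.trans_lt hq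
    rcases le_or_gt q 1 with h1 | h1
    · exact C.qc_le (q := ⟨q, hq0.le, h1⟩) hq0 (C.empties_of_qbp_lt (q := ⟨q, hq0.le, h1⟩) hq)
    · exact (C.qc_le (q := 1) zero_lt_one C.empties_one).trans h1.le
  · refine le_csInf ?_ ?_
    · exact ⟨(1 : I), (1 : I).2, zero_lt_one, C.empties_one.isSimpleEigenvalue zero_lt_one⟩
    rintro q ⟨hq, hq0, hs⟩
    exact C.qbp_le (q := ⟨q, hq⟩) (C.empties_of_isSimpleEigenvalue hq0 hs)

end InfluenceClasses

end KCSM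

theorem mainTheorem4 {d : ℕ} (C : KCSM.InfluenceClasses d) :
    C.qc = C.qbp ∧
      ∀ q : unitInterval, C.qc < (q : ℝ) → KCSM.IsSimpleEigenvalue (C.generator q) 0 := by
  refine ⟨C.qc_eq_qbp, fun q hq => ?_⟩
  rw [C.qc_eq_qbp] at hq
  exact (C.empties_of_qbp_lt hq).isSimpleEigenvalue (C.qbp_nonneg.trans_lt hq)
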